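/- For an entire function $f:\mathbb{C}\to\mathbb{C}$, a critical value of $f$ is a point $f(z)$ with $f'(z)=0$, and an asymptotic value of $f$ is a point $w\in\mathbb{C}$ for which there is a path (continuous map) $\gamma:[0,\infty)\to\mathbb{C}$ with $\gamma(t)\to\infty$ and $f(\gamma(t))\to w$ as $t\to\infty$. Let $CV(f)$ and $AV(f)$ denote the sets of critical and of asymptotic values of $f$. The set of singular values of $f$ is $S(f)=\overline{AV(f)\cup CV(f)}$, the closure being taken in $\mathbb{C}$. The function $f$ is locally univalent if every point of $\mathbb{C}$ has a neighbourhood on which $f$ is injective. Theorem (Heins). For every closed set $V\subset\mathbb{C}$ there exists a locally univalent entire function $f$ with $S(f)=V$. -/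

import Mathlib

open Filter Topology

namespace EntireFunction

/-- `f` is locally univalent: every point has a neighbourhood on which `f` is injective. -/
def LocallyUnivalent (f : ℂ → ℂ) : Prop :=
  ∀ z : ℂ, ∃ U ∈ 𝓝 z, Set.InjOn f U

/-- The set `CV(f)` of critical values: the images of the zeros of `f'`
(meant for differentiable `f`). -/
def criticalValues (f : ℂ → ℂ) : Set ℂ :=
  {w | ∃ z : ℂ, deriv f z = 0 ∧ f z = w}

/-- The set `AV(f)` of (finite) asymptotic values: the limits of `f` along paths
`γ : [0, ∞) → ℂ` that tend to `∞`. -/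
def asymptoticValues (f : ℂ → ℂ) : Set ℂ :=
  {w | ∃ γ : ℝ → ℂ, ContinuousOn γ (Set.Ici 0) ∧
    Tendsto γ atTop (cocompact ℂ) ∧ Tendsto (fun t => f (γ t)) atTop (𝓝 w)}

/-- The set of singular values, `S(f)`: the closure of `AV(f) ∪ CV(f)`. -/
def singularValues (f : ℂ → ℂ) : Set ℂ :=
  closure (asymptoticValues f ∪ criticalValues f)

end EntireFunction

/-!
Apart from the cases `V = ∅` (the identity) and `V = {a}` (`a + exp`), the function is an infinite
composition of exponentials. Fix `a ∈ V` and a dense sequence `v n` of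
`V \ {a}`. Let `F 0 = a + exp` and `F (n + 1) = F n ∘ E n`, where `E n z = b (1 - exp (-z / b))` is
locally univalent and omits `b` only; the point `b = b n` is chosen with `F n b = v n` and of so
large modulus that `E n` is nearly the identity on a large disc. Then `G n = E n ∘ E (n + 1) ∘ ⋯`
converges (`exists_infinite_comp`), `G n → id` locally uniformly, and `f = F n ∘ G n` for every `n`
is a locally univalent entire function.

*Every point of `V` is a limit of asymptotic values.* A locally univalent entire function that
omits `c` has asymptotic values arbitrarily close to `c`, because a segment towards `c` cannot be
lifted completely, and a maximal lift of it escapes to infinity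
(`mem_closure_asymptoticValues_of_omitted`). Now `f` omits `a`, and `G n` omits `b n`, which `F n`
maps to `v n`.

*There are no asymptotic values outside `V`.* Since the value omitted by `E n` is mapped into `V`,
taking logarithms shows that each `F n` has holomorphic inverse branches on every disc in the
complement of `V` (`HasBranches.comp_exp`). This survives in the limit
(`asymptoticValues_subset_compl`): if `f (γ t)` stays in such a disc, then `G n (γ t)` is the value
at `f (γ t)` of a branch of the inverse of `F n`. These branches are univalent, and near the
starting point they are close to a local inverse of `f`, so that they form a normal family
(`exists_bound_of_injOn`) and `γ` is bounded.
-/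

namespace EntireFunction

open Metric

/-! ### Inverse branches and univalent functions -/

lemma isLocalHomeomorph_of_deriv_ne_zero {f : ℂ → ℂ} (hf : Differentiable ℂ f)
    (h : ∀ z, deriv f z ≠ 0) : IsLocalHomeomorph f := by
  intro z
  have hs : HasStrictDerivAt f (deriv f z) z :=
    (hf.analyticAt z).hasStrictDerivAt
  have hs' := hs.hasStrictFDerivAt_equiv (h z)
  exact ⟨hs'.toOpenPartialHomeomorph f, hs'.mem_toOpenPartialHomeomorph_source, rfl⟩

/-- Uniqueness of lifts through an entire function without critical points. -/
lemma eqOn_of_comp_eqOn {f : ℂ → ℂ} (hf : Differentiable ℂ f) (h : ∀ z, deriv f z ≠ 0)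
    {A : Type*} [TopologicalSpace A] {s : Set A} (hs : IsPreconnected s) {g₁ g₂ : A → ℂ}
    (h₁ : ContinuousOn g₁ s) (h₂ : ContinuousOn g₂ s) (he : ∀ x ∈ s, f (g₁ x) = f (g₂ x))
    {a : A} (ha : a ∈ s) (haa : g₁ a = g₂ a) : Set.EqOn g₁ g₂ s :=
  (T2Space.isSeparatedMap f).eqOn_of_comp_eqOn
    (isLocalHomeomorph_of_deriv_ne_zero hf h).isLocallyInjective hs h₁ h₂ he ha haa

lemma locallyUnivalent_of_deriv_ne_zero {f : ℂ → ℂ} (hf : Differentiable ℂ f)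
    (h : ∀ z, deriv f z ≠ 0) : LocallyUnivalent f := fun z =>
  isLocallyInjective_iff_nhds.1 (isLocalHomeomorph_of_deriv_ne_zero hf h).isLocallyInjective z

/-- Every disc contained in `U` and centred at a value `F z₀` carries a holomorphic branch of
the inverse of `F` that takes the centre to `z₀`. -/
def HasBranches (F : ℂ → ℂ) (U : Set ℂ) : Prop :=
  ∀ (z₀ : ℂ) (R : ℝ), 0 < R → ball (F z₀) R ⊆ U → ∃ φ : ℂ → ℂ,
    DifferentiableOn ℂ φ (ball (F z₀) R) ∧ φ (F z₀) = z₀ ∧ ∀ w ∈ ball (F z₀) R, F (φ w) = w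

lemma hasBranches_id (U : Set ℂ) : HasBranches id U :=
  fun _ _ _ _ => ⟨id, differentiableOn_id, rfl, fun _ _ => rfl⟩

/-- A nonvanishing holomorphic function on a disc has a logarithm there. -/
lemma exists_log_ball {q : ℂ → ℂ} {p c : ℂ} {R : ℝ} (hR : 0 < R)
    (hq : DifferentiableOn ℂ q (ball p R)) (h0 : ∀ w ∈ ball p R, q w ≠ 0)
    (hc : Complex.exp c = q p) :
    ∃ k : ℂ → ℂ, DifferentiableOn ℂ k (ball p R) ∧ k p = c ∧
      ∀ w ∈ ball p R, Complex.exp (k w) = q w := by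
  have hd : DifferentiableOn ℂ (fun w => deriv q w / q w) (ball p R) :=
    (hq.deriv isOpen_ball).div hq h0
  obtain ⟨k, hkp, hk⟩ := hd.isExactOn_ball.with_val_at p c
  have hkd : DifferentiableOn ℂ k (ball p R) := fun w hw =>
    (hk w hw).differentiableAt.differentiableWithinAt
  have hp : p ∈ ball p R := mem_ball_self hR
  refine ⟨k, hkd, hkp, fun w hw => ?_⟩
  -- `q exp (-k)` is constant.
  have key : ∀ x ∈ ball p R, HasDerivAt (fun w => q w * Complex.exp (-k w)) 0 x := by
    intro x hx
    have h1 : HasDerivAt q (deriv q x) x :=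
      (hq.differentiableAt (isOpen_ball.mem_nhds hx)).hasDerivAt
    refine (h1.mul (hk x hx).neg.cexp).congr_deriv ?_
    linear_combination -Complex.exp (-k x) * div_mul_cancel₀ (deriv q x) (h0 x hx)
  have hconst : q w * Complex.exp (-k w) = q p * Complex.exp (-k p) := by
    refine isOpen_ball.is_const_of_deriv_eq_zero (convex_ball p R).isPreconnected
      (fun x hx => (key x hx).differentiableAt.differentiableWithinAt)
      (fun x hx => (key x hx).deriv) hw hp
  rw [hkp, ← hc, ← Complex.exp_add, add_neg_cancel, Complex.exp_zero, Complex.exp_neg] at hconst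
  field_simp at hconst
  exact hconst.symm

/-- Precomposition with the exponential map `z ↦ β + α exp (μ z)`, which omits only `β`, keeps
the branches over `U` as long as `F β ∉ U`. -/
lemma HasBranches.comp_exp {F : ℂ → ℂ} {U : Set ℂ} (hF : HasBranches F U) {α β μ : ℂ}
    (hα : α ≠ 0) (hμ : μ ≠ 0) (hβ : F β ∉ U) :
    HasBranches (fun z => F (β + α * Complex.exp (μ * z))) U := by
  intro z₀ R hR hU
  obtain ⟨φ, hφ, hφ0, hφF⟩ := hF (β + α * Complex.exp (μ * z₀)) R hR hU
  set p := F (β + α * Complex.exp (μ * z₀)) with hp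
  obtain ⟨k, hk, hkp, hke⟩ := exists_log_ball (c := μ * z₀) (q := fun w => (φ w - β) / α) hR
    ((hφ.sub_const β).div_const α) (fun w hw h => by
      have : φ w = β := by
        have := (div_eq_zero_iff.1 h).resolve_right hα
        exact sub_eq_zero.1 this
      exact hβ (by rw [← this, hφF w hw]; exact hU hw)) (by rw [hφ0]; field_simp; ring)
  refine ⟨fun w => k w / μ, hk.div_const μ, by
    change k p / μ = z₀
    rw [hkp]; field_simp, fun w hw => ?_⟩
  have h1 : β + α * Complex.exp (μ * (k w / μ)) = φ w := by
    rw [mul_div_cancel₀ _ hμ, hke w hw]; field_simp; ring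
  simp only [h1, hφF w hw]

/-- A Harnack inequality: a holomorphic function on a disc that is bounded away from `0` is
bounded on smaller concentric discs in terms of its value at the centre. -/
lemma exists_bound_of_bounded_below {m C R R' : ℝ} (hm : 0 < m) (hR' : 0 ≤ R') (hRR : R' < R) :
    ∃ B : ℝ, ∀ (q : ℂ → ℂ) (p : ℂ), DifferentiableOn ℂ q (ball p R) →
      (∀ w ∈ ball p R, m ≤ ‖q w‖) → ‖q p‖ ≤ C → ∀ w ∈ closedBall p R', ‖q w‖ ≤ B := by
  have hR : 0 < R := hR'.trans_lt hRR
  -- The real part of `log (q / m)` is nonnegative, so Borel–Carathéodory bounds this logarithm;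
  -- `π` bounds the imaginary part of its principal value at the centre.
  refine ⟨m * Real.exp (2 * 1 * R' / (R - R') +
    (Real.log (C / m) + Real.pi) * (R + R') / (R - R')), fun q p hq hlow hC w hw => ?_⟩
  have hp : p ∈ ball p R := mem_ball_self hR
  have hw' : w ∈ ball p R := closedBall_subset_ball hRR hw
  have hmC : (m : ℂ) ≠ 0 := by exact_mod_cast hm.ne'
  have hq0 : ∀ w ∈ ball p R, q w ≠ 0 := fun w hw h => by
    have := hlow w hw; rw [h, norm_zero] at this; linarith
  have hnorm : ∀ w, ‖q w / m‖ = ‖q w‖ / m := fun w => by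
    rw [norm_div, Complex.norm_real, Real.norm_of_nonneg hm.le]
  obtain ⟨k, hk, hkp, hke⟩ := exists_log_ball (c := Complex.log (q p / m)) (q := fun w => q w / m)
    hR (hq.div_const _) (fun w hw => div_ne_zero (hq0 w hw) hmC)
    (Complex.exp_log (div_ne_zero (hq0 p hp) hmC))
  have hre : ∀ w ∈ ball p R, ‖q w‖ = m * Real.exp (k w).re := fun w hw => by
    rw [← Complex.norm_exp, hke w hw, hnorm]; field_simp
  have hre0 : ∀ w ∈ ball p R, 0 ≤ (k w).re := fun w hw => by
    have h1 := hlow w hw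
    rw [hre w hw] at h1
    have : 1 ≤ Real.exp (k w).re := by
      by_contra hlt
      push Not at hlt
      nlinarith
    exact Real.one_le_exp_iff.1 this
  have hmaps : Set.MapsTo (fun x => p + x) (ball 0 R) (ball p R) := fun x hx => by
    simpa [mem_ball, dist_eq_norm] using hx
  have hBC := Complex.borelCaratheodory (f := fun x => -k (p + x)) (M := 1) (R := R) (z := w - p)
    one_pos ((hk.comp (by fun_prop) hmaps).neg)
    (fun x hx => by
      have := hre0 _ (hmaps hx)
      simp only [Set.mem_ofPred_eq, Complex.neg_re]
      linarith) hR (by simpa [dist_eq_norm] using hw')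
  simp only [norm_neg, add_sub_cancel, add_zero] at hBC
  have hwn : ‖w - p‖ ≤ R' := by simpa [dist_eq_norm] using hw
  have hkn : ‖k p‖ ≤ Real.log (C / m) + Real.pi := by
    rw [hkp]
    refine (Complex.norm_le_abs_re_add_abs_im _).trans (add_le_add ?_ ?_)
    · have h1 : 1 ≤ ‖q p / m‖ := by rw [hnorm, le_div_iff₀ hm]; simpa using hlow p hp
      rw [Complex.log_re, abs_of_nonneg (Real.log_nonneg h1)]
      refine Real.log_le_log (by linarith) ?_
      rw [hnorm]; gcongr
    · rw [Complex.log_im]; exact Complex.abs_arg_le_pi _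
  have hL : 0 ≤ Real.log (C / m) + Real.pi := (norm_nonneg _).trans hkn
  rw [hre w hw']
  gcongr
  refine (Complex.re_le_norm _).trans (hBC.trans ?_)
  have : 0 < R - R' := by linarith
  gcongr

/-- Normality of univalent maps: if the image of a small disc about the centre is bounded and
contains a disc of fixed size, then the map is bounded on every smaller concentric disc by a
constant that depends on these sizes only. -/
lemma exists_bound_of_injOn {ρ R R' σ A : ℝ} (hρ : 0 < ρ) (hρR : ρ < R) (hR' : 0 ≤ R')
    (hRR : R' < R) (hσ : 0 < σ) :
    ∃ B : ℝ, ∀ (φ : ℂ → ℂ) (p : ℂ), DifferentiableOn ℂ φ (ball p R) → Set.InjOn φ (ball p R) →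
      deriv φ p ≠ 0 → ball (φ p) σ ⊆ φ '' ball p ρ → (∀ w ∈ ball p ρ, ‖φ w - φ p‖ ≤ A) →
      ∀ w ∈ closedBall p R', ‖φ w - φ p‖ ≤ B := by
  have hR : 0 < R := hρ.trans hρR
  obtain ⟨B, hB⟩ := exists_bound_of_bounded_below (C := A / (ρ / 2)) (div_pos hσ hR) hR' hRR
  refine ⟨B * R', fun φ p hφ hinj hd himg hA w hw => ?_⟩
  have hp : p ∈ ball p R := mem_ball_self hR
  have hnhds : ball p R ∈ 𝓝 p := isOpen_ball.mem_nhds hp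
  -- The difference quotient at the centre is holomorphic and does not vanish, by univalence.
  set q := dslope φ p with hq
  have hqd : DifferentiableOn ℂ q (ball p R) := (Complex.differentiableOn_dslope hnhds).2 hφ
  have hmul : ∀ w, (w - p) * q w = φ w - φ p := fun w => by
    simpa using sub_smul_dslope φ p w
  have hq0 : ∀ w ∈ ball p R, q w ≠ 0 := by
    intro w hw h0
    by_cases hwp : w = p
    · rw [hwp, hq, dslope_same] at h0; exact hd h0
    · have := hmul w
      rw [h0, mul_zero] at this
      exact hwp (hinj hw hp (sub_eq_zero.1 this.symm))
  -- Outside the small disc, univalence keeps `φ` away from the disc covered by the small one.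
  have hfar : ∀ w ∈ ball p R, ρ ≤ dist w p → σ / R ≤ ‖q w‖ := by
    intro w hw hρw
    have h1 : σ ≤ ‖φ w - φ p‖ := by
      by_contra hlt
      push Not at hlt
      obtain ⟨x, hx, hxw⟩ := himg (mem_ball_iff_norm.2 hlt)
      have := hinj (ball_subset_ball hρR.le hx) hw hxw
      rw [this, mem_ball] at hx
      linarith
    rw [← hmul w, norm_mul] at h1
    have h2 : ‖w - p‖ ≤ R := by rw [← dist_eq_norm]; exact (mem_ball.1 hw).le
    rw [div_le_iff₀ hR]
    nlinarith [norm_nonneg (q w)]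
  have hlow : ∀ w ∈ ball p R, σ / R ≤ ‖q w‖ := by
    intro w hw
    rcases le_or_gt ρ (dist w p) with h | h
    · exact hfar w hw h
    have hsub : closedBall p ρ ⊆ ball p R := closedBall_subset_ball hρR
    have hinv : DiffContOnCl ℂ (fun w => (q w)⁻¹) (ball p ρ) := by
      refine ((hqd.inv hq0).mono ?_).diffContOnCl
      rw [closure_ball p hρ.ne']
      exact hsub
    have := Complex.norm_le_of_forall_mem_frontier_norm_le isBounded_ball hinv
      (C := (σ / R)⁻¹) (fun x hx => by
        rw [frontier_ball p hρ.ne'] at hx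
        rw [norm_inv]
        exact inv_anti₀ (div_pos hσ hR) (hfar x (hsub (sphere_subset_closedBall hx))
          (mem_sphere.1 hx).ge)) (subset_closure (mem_ball.2 h))
    rw [norm_inv] at this
    exact (inv_le_inv₀ (norm_pos_iff.2 (hq0 w hw)) (div_pos hσ hR)).1 this
  have hC : ‖q p‖ ≤ A / (ρ / 2) := by
    have hsub : closedBall p (ρ / 2) ⊆ ball p R := closedBall_subset_ball (by linarith)
    have := Complex.norm_deriv_le_of_forall_mem_sphere_norm_le (c := p) (R := ρ / 2) (C := A)
      (f := fun w => φ w - φ p) (by linarith)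
      (((hφ.sub_const (φ p)).mono (by rwa [closure_ball p (by linarith)])).diffContOnCl)
      (fun w hw => hA w (mem_ball.2 (by rw [mem_sphere.1 hw]; linarith)))
    rw [hq, dslope_same]
    simpa using this
  have h1 := hB q p hqd hlow hC w hw
  rw [← hmul w, norm_mul, mul_comm]
  have h2 : ‖w - p‖ ≤ R' := by simpa [dist_eq_norm] using hw
  exact mul_le_mul h1 h2 (norm_nonneg _) ((norm_nonneg _).trans h1)

/-! ### Asymptotic values of a limit -/

/-- If `f = F n ∘ G n` with `G n → id` locally uniformly and all `F n` have branches over the open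
set `U`, then `f` has no asymptotic value in `U`: along an asymptotic path `γ` the branches of
`(F n)⁻¹` take the values `G n (γ t)`, and their local boundedness, uniform in `n`, bounds `γ`. -/
lemma asymptoticValues_subset_compl {f : ℂ → ℂ} {F G : ℕ → ℂ → ℂ} {U : Set ℂ} (hU : IsOpen U)
    (hf : Differentiable ℂ f) (hf' : ∀ z, deriv f z ≠ 0)
    (hF : ∀ n, Differentiable ℂ (F n)) (hF' : ∀ n z, deriv (F n) z ≠ 0)
    (hG : ∀ n, Differentiable ℂ (G n)) (hfac : ∀ n z, F n (G n z) = f z)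
    (hlim : ∀ r ε : ℝ, 0 < ε → ∀ᶠ n in atTop, ∀ z, ‖z‖ ≤ r → ‖G n z - z‖ ≤ ε)
    (hB : ∀ n, HasBranches (F n) U) : asymptoticValues f ⊆ Uᶜ := by
  rintro w ⟨γ, hγc, hγi, hγw⟩ hwU
  obtain ⟨r', hr'0, hr'⟩ := Metric.isOpen_iff.1 hU w hwU
  -- With radius `4 r` about `w`, the disc of radius `3 r` about any point of `ball w r` is in `U`.
  obtain ⟨r, hr, rfl⟩ : ∃ r : ℝ, 0 < r ∧ r' = 4 * r := ⟨r' / 4, by positivity, by ring⟩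
  obtain ⟨t₀, ht₀⟩ := eventually_atTop.1
    ((hγw.eventually (ball_mem_nhds w hr)).and (eventually_ge_atTop (0 : ℝ)))
  have ht00 : 0 ≤ t₀ := (ht₀ t₀ le_rfl).2
  set z₀ := γ t₀ with hz₀
  set p := f z₀ with hp
  have hpw : dist p w < r := (ht₀ t₀ le_rfl).1
  have hpU : ball p (3 * r) ⊆ U := (ball_subset_ball' (by linarith)).trans hr'
  have hpath : ∀ t ∈ Set.Ici t₀, f (γ t) ∈ ball p (2 * r) := fun t ht => by
    have h1 : dist (f (γ t)) w < r := (ht₀ t ht).1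
    have := dist_triangle_right (f (γ t)) p w
    rw [mem_ball]; linarith
  have hγc' : ContinuousOn γ (Set.Ici t₀) := hγc.mono (Set.Ici_subset_Ici.2 ht00)
  obtain ⟨e, hes, hef⟩ := isLocalHomeomorph_of_deriv_ne_zero hf hf' z₀
  have hep : e z₀ = p := by rw [← hef]
  have hpt : p ∈ e.target := hep ▸ e.map_source hes
  have hψp : e.symm p = z₀ := by rw [← hep, e.left_inv hes]
  -- A small disc about `p` on which the local inverse of `f` is defined and close to `z₀`.
  obtain ⟨ρ₀, hρ₀, hρsub⟩ := Metric.mem_nhds_iff.1 (inter_mem (e.open_target.mem_nhds hpt)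
    ((e.continuousAt_symm hpt).preimage_mem_nhds
      (by rw [hψp]; exact ball_mem_nhds z₀ one_pos)))
  set ρ := min ρ₀ (2 * r) with hρdef
  have hρ : 0 < ρ := lt_min hρ₀ (by linarith)
  have hρR : ρ < 3 * r := (min_le_right _ _).trans_lt (by linarith)
  have hρt : ∀ x ∈ ball p ρ, x ∈ e.target ∧ dist (e.symm x) z₀ < 1 := fun x hx =>
    hρsub (ball_subset_ball (min_le_left _ _) hx)
  obtain ⟨s, hs, hssub⟩ := Metric.nhds_basis_closedBall.mem_iff.1
    (inter_mem (e.open_source.mem_nhds hes)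
      (hf.continuous.continuousAt.preimage_mem_nhds (ball_mem_nhds p hρ)))
  obtain ⟨B, hBd⟩ := exists_bound_of_injOn (R := 3 * r) (R' := 2 * r) (σ := s / 2 / 2) (A := 3)
    hρ hρR (by linarith) (by linarith) (by positivity)
  have hev : ∀ᶠ n in atTop, ∀ t ∈ Set.Ici t₀, ‖G n (γ t) - G n z₀‖ ≤ B := by
    filter_upwards [hlim (‖z₀‖ + s + 1) (min (s / 4) 1) (by positivity)] with n hn t ht
    have hn1 : ∀ z, dist z z₀ ≤ s + 1 → ‖G n z - z‖ ≤ min (s / 4) 1 := fun z hz => hn z (by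
      have := norm_le_norm_add_norm_sub' z z₀
      rw [← dist_eq_norm] at this
      linarith)
    have hFG : F n (G n z₀) = p := hfac n z₀
    obtain ⟨φ, hφ, hφp, hφF⟩ := hB n (G n z₀) (3 * r) (by linarith) (by rwa [hFG])
    rw [hFG] at hφ hφp hφF
    have hpR : p ∈ ball p (3 * r) := mem_ball_self (by linarith)
    have hinj : Set.InjOn φ (ball p (3 * r)) := fun x hx y hy hxy => by
      rw [← hφF x hx, hxy, hφF y hy]
    have hderiv : deriv φ p ≠ 0 := by
      intro h0
      have h1 : HasDerivAt φ (deriv φ p) p :=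
        (hφ.differentiableAt (isOpen_ball.mem_nhds hpR)).hasDerivAt
      have h2 := (hF n (φ p)).hasDerivAt.comp p h1
      have h3 : F n ∘ φ =ᶠ[𝓝 p] id := by
        filter_upwards [isOpen_ball.mem_nhds hpR] with x hx using hφF x hx
      have := h2.unique ((hasDerivAt_id p).congr_of_eventuallyEq h3)
      rw [h0, mul_zero] at this
      exact zero_ne_one this
    -- Near `p`, the branch `φ` of the inverse of `F n` is `G n` after the local inverse of `f`.
    have hφG : Set.EqOn φ (fun x => G n (e.symm x)) (ball p ρ) := by
      refine eqOn_of_comp_eqOn (hF n) (hF' n) (convex_ball p ρ).isPreconnected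
        (hφ.continuousOn.mono (ball_subset_ball hρR.le))
        ((hG n).continuous.comp_continuousOn (e.continuousOn_symm.mono fun x hx => (hρt x hx).1))
        (fun x hx => ?_) (mem_ball_self hρ) (by simp only [hφp, hψp])
      rw [hφF x (ball_subset_ball hρR.le hx), hfac, hef, e.right_inv (hρt x hx).1]
    have himg : ball (φ p) (s / 2 / 2) ⊆ φ '' ball p ρ := by
      have hsph : ∀ z ∈ sphere z₀ s, s / 2 ≤ ‖G n z - G n z₀‖ := fun z hz => by
        have hz' : dist z z₀ = s := hz
        have h1 := (hn1 z (by linarith)).trans (min_le_left _ _)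
        have h2 := (hn1 z₀ (by rw [dist_self]; linarith)).trans (min_le_left _ _)
        rw [dist_eq_norm] at hz'
        have h3 : ‖z - z₀‖ ≤ ‖G n z - G n z₀‖ + ‖G n z - z‖ + ‖G n z₀ - z₀‖ := by
          have : z - z₀ = (G n z - G n z₀) - (G n z - z) + (G n z₀ - z₀) := by ring
          rw [this]
          exact (norm_add_le _ _).trans (add_le_add_left (norm_sub_le _ _) _)
        linarith
      have hcov := (hG n).diffContOnCl.ball_subset_image_closedBall (z₀ := z₀) hs hsph (by
        by_contra hcon
        rw [Filter.not_frequently] at hcon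
        have h1 : G n =ᶠ[𝓝 z₀] fun _ => G n z₀ := hcon.mono fun z hz => not_not.1 hz
        have h2 : f =ᶠ[𝓝 z₀] fun _ => f z₀ := h1.mono fun z hz => by
          simp only [← hfac n]
          rw [hz]
        exact hf' z₀ (by rw [h2.deriv_eq, deriv_const]))
      rw [hφp]
      intro x hx
      obtain ⟨y, hy, rfl⟩ := hcov hx
      obtain ⟨hys, hyρ⟩ := hssub hy
      refine ⟨f y, hyρ, ?_⟩
      rw [hφG hyρ]
      simp only [hef]
      rw [e.left_inv hys]
    have hA : ∀ x ∈ ball p ρ, ‖φ x - φ p‖ ≤ 3 := fun x hx => by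
      rw [hφp, hφG hx]
      have hd := (hρt x hx).2
      have h1 := (hn1 (e.symm x) (by linarith)).trans (min_le_right _ _)
      have h2 := (hn1 z₀ (by rw [dist_self]; linarith)).trans (min_le_right _ _)
      rw [dist_eq_norm] at hd
      have : G n (e.symm x) - G n z₀ =
        (G n (e.symm x) - e.symm x) + (e.symm x - z₀) - (G n z₀ - z₀) := by ring
      rw [this]
      have h3 := norm_sub_le ((G n (e.symm x) - e.symm x) + (e.symm x - z₀)) (G n z₀ - z₀)
      have h4 := norm_add_le (G n (e.symm x) - e.symm x) (e.symm x - z₀)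
      linarith
    have hlift : Set.EqOn (fun t => G n (γ t)) (fun t => φ (f (γ t))) (Set.Ici t₀) := by
      have hsub : ball p (2 * r) ⊆ ball p (3 * r) := ball_subset_ball (by linarith)
      refine eqOn_of_comp_eqOn (hF n) (hF' n) isPreconnected_Ici
        ((hG n).continuous.comp_continuousOn hγc')
        (hφ.continuousOn.comp (hf.continuous.comp_continuousOn hγc')
          fun t ht => hsub (hpath t ht))
        (fun t ht => ?_) Set.self_mem_Ici hφp.symm
      rw [hfac, hφF _ (hsub (hpath t ht))]
    have h1 := hBd φ p hφ hinj hderiv himg hA _ (ball_subset_closedBall (hpath t ht))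
    rwa [← show G n (γ t) = φ (f (γ t)) from hlift ht, hφp] at h1
  have hbd : ∀ t ∈ Set.Ici t₀, γ t ∈ closedBall z₀ (B + 2) := fun t ht => by
    obtain ⟨n, h1, h2⟩ := (hev.and (hlim (max ‖γ t‖ ‖z₀‖) 1 one_pos)).exists
    have h3 := h2 (γ t) (le_max_left _ _)
    have h4 := h2 z₀ (le_max_right _ _)
    have h5 := h1 t ht
    rw [mem_closedBall, dist_eq_norm]
    have : γ t - z₀ = (G n (γ t) - G n z₀) - (G n (γ t) - γ t) + (G n z₀ - z₀) := by ring
    rw [this]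
    have h6 := norm_add_le ((G n (γ t) - G n z₀) - (G n (γ t) - γ t)) (G n z₀ - z₀)
    have h7 := norm_sub_le (G n (γ t) - G n z₀) (G n (γ t) - γ t)
    linarith
  obtain ⟨t, ht1, ht2⟩ := ((hγi.eventually
    (isCompact_closedBall z₀ (B + 2)).compl_mem_cocompact).and (eventually_ge_atTop t₀)).exists
  exact ht1 (hbd t ht2)

/-! ### Path lifting and omitted values -/

/-- `IsLift h δ z₀ T γ`: the path `γ` lifts `δ` through `h` over `[0, T]`, starting at `z₀`. -/
def IsLift (h : ℂ → ℂ) (δ : ℝ → ℂ) (z₀ : ℂ) (T : ℝ) (γ : ℝ → ℂ) : Prop :=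
  ContinuousOn γ (Set.Icc 0 T) ∧ γ 0 = z₀ ∧ ∀ t ∈ Set.Icc 0 T, h (γ t) = δ t

lemma IsLift.mono {h : ℂ → ℂ} {δ : ℝ → ℂ} {z₀ : ℂ} {T T' : ℝ} {γ : ℝ → ℂ}
    (hγ : IsLift h δ z₀ T γ) (hT : T' ≤ T) : IsLift h δ z₀ T' γ :=
  ⟨hγ.1.mono (Set.Icc_subset_Icc_right hT), hγ.2.1,
    fun t ht => hγ.2.2 t (Set.Icc_subset_Icc_right hT ht)⟩

/-- A lift whose endpoint lies in the domain of a local inverse continues as long as the path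
stays in the domain of that inverse. -/
lemma IsLift.extend {h : ℂ → ℂ} {δ : ℝ → ℂ} (hδ : Continuous δ) {z₀ : ℂ} {T T' : ℝ} {γ : ℝ → ℂ}
    (hγ : IsLift h δ z₀ T γ) (hT : 0 ≤ T) (hTT : T ≤ T') (e : OpenPartialHomeomorph ℂ ℂ)
    (he : h = e) (hs : γ T ∈ e.source) (ht : ∀ t ∈ Set.Icc T T', δ t ∈ e.target) :
    ∃ γ', IsLift h δ z₀ T' γ' := by
  obtain ⟨hc, h0, hl⟩ := hγ
  have hglue : e.symm (δ T) = γ T := by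
    rw [← hl T ⟨hT, le_rfl⟩, he, e.left_inv hs]
  have hr : ∀ t, T ≤ t → (if t ≤ T then γ t else e.symm (δ t)) = e.symm (δ t) := by
    intro t htT
    split_ifs with h
    · rw [le_antisymm h htT, hglue]
    · rfl
  refine ⟨fun t => if t ≤ T then γ t else e.symm (δ t), ?_, by simp [hT, h0], ?_⟩
  · rw [← Set.Icc_union_Icc_eq_Icc hT hTT]
    refine ContinuousOn.union_of_isClosed ?_ ?_ isClosed_Icc isClosed_Icc
    · exact hc.congr fun t ht => if_pos ht.2
    · exact (e.continuousOn_symm.comp hδ.continuousOn ht).congr fun t ht => hr t ht.1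
  · intro t ht'
    rcases le_total t T with h | h
    · simp only [if_pos h]; exact hl t ⟨ht'.1, h⟩
    · simp only [hr t h]
      rw [he, e.right_inv (ht t ⟨h, ht'.2⟩)]

/-- Lifting a path through a locally univalent entire function either succeeds or produces an
asymptotic value on the path. -/
lemma exists_lift_or_asymptoticValue {h : ℂ → ℂ} (hd : Differentiable ℂ h)
    (hd' : ∀ z, deriv h z ≠ 0) {δ : ℝ → ℂ} (hδ : Continuous δ) {z₀ : ℂ} (h0 : h z₀ = δ 0) :
    (∃ γ, IsLift h δ z₀ 1 γ) ∨ ∃ T ∈ Set.Ioc (0 : ℝ) 1, δ T ∈ asymptoticValues h := by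
  by_contra! hcon
  obtain ⟨hno, hna⟩ := hcon
  have hloc := isLocalHomeomorph_of_deriv_ne_zero hd hd'
  set S : Set ℝ := {T | T ∈ Set.Icc (0 : ℝ) 1 ∧ ∃ γ, IsLift h δ z₀ T γ} with hS
  have h0S : (0 : ℝ) ∈ S := ⟨by simp, fun _ => z₀, continuousOn_const, rfl, fun t ht => by
    rw [Set.Icc_self] at ht; rw [ht, h0]⟩
  have hbdd : BddAbove S := ⟨1, fun T hT => hT.1.2⟩
  set T := sSup S with hT
  have hT0 : 0 ≤ T := le_csSup hbdd h0S
  have hT1 : T ≤ 1 := csSup_le ⟨0, h0S⟩ fun T hT => hT.1.2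
  have hnear : ∀ V : Set ℂ, IsOpen V → δ T ∈ V →
      ∃ η > 0, ∀ t ∈ Set.Icc (T - η) (T + η), δ t ∈ V := fun V hV hTV => by
    obtain ⟨η, hη, hsub⟩ := Metric.nhds_basis_closedBall.mem_iff.1
      (hδ.continuousAt.preimage_mem_nhds (hV.mem_nhds hTV))
    rw [Real.closedBall_eq_Icc] at hsub
    exact ⟨η, hη, fun t ht => hsub ht⟩
  have hTS : T ∉ S := by
    rintro ⟨-, γ, hγ⟩
    obtain ⟨e, hes, hef⟩ := hloc (γ T)
    have hval : h (γ T) = δ T := hγ.2.2 T ⟨hT0, le_rfl⟩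
    obtain ⟨η, hη, hsub⟩ := hnear e.target e.open_target (by
      rw [← hval, hef]; exact e.map_source hes)
    have hlt : T < 1 := lt_of_le_of_ne hT1 fun h1 => hno γ (h1 ▸ hγ)
    have hmem : min (T + η) 1 ∈ S := by
      refine ⟨⟨le_min (by linarith) zero_le_one, min_le_right _ _⟩, ?_⟩
      refine hγ.extend hδ hT0 (le_min (by linarith) hT1) e hef hes fun t ht => hsub t
        ⟨by linarith [ht.1], ht.2.trans (min_le_left _ _)⟩
    have := le_csSup hbdd hmem
    rw [← hT] at this
    exact absurd this (not_le.2 (lt_min (by linarith) hlt))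
  have hTpos : 0 < T := lt_of_le_of_ne hT0 fun h => hTS (h ▸ h0S)
  have hSmem : ∀ t, 0 ≤ t → t < T → t ∈ S := fun t ht htT => by
    obtain ⟨T', ⟨hT', γ, hγ⟩, htT'⟩ := exists_lt_of_lt_csSup ⟨0, h0S⟩ htT
    exact ⟨⟨ht, htT'.le.trans hT'.2⟩, γ, hγ.mono htT'.le⟩
  have hex : ∀ t, ∃ γ, 0 ≤ t → t < T → IsLift h δ z₀ t γ := fun t => by
    by_cases ht : 0 ≤ t ∧ t < T
    · obtain ⟨-, γ, hγ⟩ := hSmem t ht.1 ht.2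
      exact ⟨γ, fun _ _ => hγ⟩
    · exact ⟨0, fun h1 h2 => (ht ⟨h1, h2⟩).elim⟩
  choose g hg using hex
  -- By uniqueness of lifts, the lifts over the intervals `[0, t]` fit together.
  set γ : ℝ → ℂ := fun t => g t t with hγdef
  have hγeq : ∀ t, 0 ≤ t → t < T → Set.EqOn γ (g t) (Set.Icc 0 t) := by
    intro t ht htT s hs
    have h1 := hg s hs.1 (hs.2.trans_lt htT)
    have h2 := (hg t ht htT).mono hs.2
    exact eqOn_of_comp_eqOn hd hd' isPreconnected_Icc h1.1 h2.1
      (fun x hx => by rw [h1.2.2 x hx, h2.2.2 x hx]) (Set.left_mem_Icc.2 hs.1)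
      (by rw [h1.2.1, h2.2.1]) (Set.right_mem_Icc.2 hs.1)
  have hγlift : ∀ t, 0 ≤ t → t < T → IsLift h δ z₀ t γ := fun t ht htT => by
    have h1 := hg t ht htT
    have h2 := hγeq t ht htT
    exact ⟨h1.1.congr h2, by rw [h2 (Set.left_mem_Icc.2 ht), h1.2.1],
      fun s hs => by rw [h2 hs, h1.2.2 s hs]⟩
  have hγc : ContinuousOn γ (Set.Ico 0 T) := by
    intro t ht
    obtain ⟨t', htt', ht'T⟩ := exists_between ht.2
    have h1 := (hγlift t' (ht.1.trans htt'.le) ht'T).1 t ⟨ht.1, htt'.le⟩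
    refine h1.mono_of_mem_nhdsWithin ?_
    filter_upwards [self_mem_nhdsWithin, mem_nhdsWithin_of_mem_nhds (Iio_mem_nhds htt')]
      with x hx hx'
    exact ⟨hx.1, le_of_lt hx'⟩
  have hev : ∀ᶠ t in 𝓝[<] T, t ∈ Set.Ioo 0 T := Ioo_mem_nhdsLT hTpos
  have hδT : Tendsto δ (𝓝[<] T) (𝓝 (δ T)) := hδ.continuousAt.tendsto.mono_left nhdsWithin_le_nhds
  have hhγ : Tendsto (h ∘ γ) (𝓝[<] T) (𝓝 (δ T)) := hδT.congr' (by
    filter_upwards [hev] with t ht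
    exact ((hγlift t ht.1.le ht.2).2.2 t ⟨ht.1.le, le_rfl⟩).symm)
  by_cases hinf : Tendsto γ (𝓝[<] T) (cocompact ℂ)
  · -- The maximal lift escapes to infinity; reparametrize it over `[0, ∞)`.
    refine hna T ⟨hTpos, hT1⟩ ?_
    have hσ : ∀ s : ℝ, 0 ≤ s → T * (1 - 1 / (1 + s)) ∈ Set.Ico 0 T := fun s hs => by
      have h1 : 0 < 1 / (1 + s) := by positivity
      have h2 : 1 / (1 + s) ≤ 1 := by rw [div_le_one (by linarith)]; linarith
      exact ⟨mul_nonneg hT0 (by linarith), by nlinarith⟩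
    have hσlim : Tendsto (fun s : ℝ => T * (1 - 1 / (1 + s))) atTop (𝓝[<] T) := by
      refine tendsto_nhdsWithin_iff.2 ⟨?_, ?_⟩
      · have h1 : Tendsto (fun s : ℝ => 1 / (1 + s)) atTop (𝓝 0) :=
          tendsto_const_nhds.div_atTop (tendsto_atTop_add_const_left _ 1 tendsto_id)
        simpa using (tendsto_const_nhds (x := (1 : ℝ)).sub h1).const_mul T
      · filter_upwards [eventually_ge_atTop 0] with s hs using (hσ s hs).2
    refine ⟨fun s => γ (T * (1 - 1 / (1 + s))), ?_, hinf.comp hσlim, hhγ.comp hσlim⟩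
    refine hγc.comp ?_ fun s hs => hσ s hs
    refine continuousOn_const.mul (continuousOn_const.sub (continuousOn_const.div
      (by fun_prop) fun s hs => ?_))
    have : (0 : ℝ) ≤ s := hs
    positivity
  · -- Otherwise it has a finite cluster point, at which a local inverse of `h` extends it to `T`.
    obtain ⟨K, hK, hfreq⟩ : ∃ K : Set ℂ, IsCompact K ∧ ∃ᶠ t in 𝓝[<] T, γ t ∈ K := by
      rw [(hasBasis_cocompact).tendsto_right_iff] at hinf
      push Not at hinf
      obtain ⟨K, hK, hfr⟩ := hinf
      exact ⟨K, hK, hfr.mono fun t ht => by simpa using ht⟩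
    obtain ⟨z, -, hz⟩ := hK.exists_mapClusterPt_of_frequently hfreq
    have hzT : h z = δ T := by
      have h1 : MapClusterPt (h z) (𝓝[<] T) (h ∘ γ) := hz.tendsto_comp hd.continuous.continuousAt
      have h2 : ClusterPt (h z) (𝓝 (δ T)) := ClusterPt.mono h1 hhγ
      exact eq_of_nhds_neBot h2
    obtain ⟨e, hes, hef⟩ := hloc z
    obtain ⟨η, hη, hsub⟩ := hnear e.target e.open_target (by
      rw [← hzT, hef]; exact e.map_source hes)
    have hfr := mapClusterPt_iff_frequently.1 hz e.source (e.open_source.mem_nhds hes)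
    obtain ⟨t, ⟨hts, ht⟩, htη⟩ := ((hfr.and_eventually hev).and_eventually
      (mem_nhdsWithin_of_mem_nhds (Ioi_mem_nhds (show T - η < T by linarith)))).exists
    have htη' : T - η < t := htη
    exact hTS ⟨⟨hT0, hT1⟩, (hγlift t ht.1.le ht.2).extend hδ ht.1.le ht.2.le e hef hts
      fun s hs => hsub s ⟨htη'.le.trans hs.1, by linarith [hs.2]⟩⟩

/-- A value omitted by a locally univalent entire function is a limit of asymptotic values. -/
lemma mem_closure_asymptoticValues_of_omitted {h : ℂ → ℂ} (hd : Differentiable ℂ h)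
    (hd' : ∀ z, deriv h z ≠ 0) {c : ℂ} (hc : ∀ z, h z ≠ c) :
    c ∈ closure (asymptoticValues h) := by
  rw [Metric.mem_closure_iff]
  intro ε hε
  -- By Liouville's theorem applied to `1 / (h - c)`, the values of `h` come close to `c`.
  obtain ⟨z₀, hz₀⟩ : ∃ z, ‖h z - c‖ < ε := by
    by_contra! hcon
    have hdi : Differentiable ℂ fun z => (h z - c)⁻¹ :=
      (hd.sub_const c).inv fun z => sub_ne_zero.2 (hc z)
    have hb : Bornology.IsBounded (Set.range fun z => (h z - c)⁻¹) := by
      refine isBounded_iff_forall_norm_le.2 ⟨ε⁻¹, ?_⟩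
      rintro _ ⟨z, rfl⟩
      rw [norm_inv]
      exact inv_anti₀ hε (hcon z)
    have hconst : h = fun _ => h 0 := funext fun z => by
      have := inv_injective (hdi.apply_eq_apply_of_bounded hb z 0)
      exact sub_left_injective this
    exact hd' 0 (by rw [hconst, deriv_const])
  set δ : ℝ → ℂ := fun t => h z₀ + t * (c - h z₀) with hδ
  rcases exists_lift_or_asymptoticValue hd hd' (δ := δ) (by fun_prop) (z₀ := z₀) (by simp [hδ])
    with ⟨γ, hγ⟩ | ⟨T, hT, hTa⟩
  · exact (hc (γ 1) (by rw [hγ.2.2 1 (by simp)]; simp [hδ])).elim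
  · refine ⟨δ T, hTa, ?_⟩
    have : c - δ T = -(((1 - T : ℝ) : ℂ) * (h z₀ - c)) := by
      simp only [hδ]; push_cast; ring
    rw [dist_eq_norm, this, norm_neg, norm_mul, Complex.norm_real,
      Real.norm_of_nonneg (by linarith [hT.2])]
    nlinarith [norm_nonneg (h z₀ - c), hT.1]

/-! ### Infinite compositions -/

/-- The composition `E k ∘ E (k + 1) ∘ ⋯ ∘ E (k + m - 1)` of `m` consecutive maps. -/
def iteratedComp (E : ℕ → ℂ → ℂ) (k : ℕ) : ℕ → ℂ → ℂ
  | 0 => id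
  | m + 1 => fun z => iteratedComp E k m (E (k + m) z)

lemma iteratedComp_add (E : ℕ → ℂ → ℂ) (k m n : ℕ) (z : ℂ) :
    iteratedComp E k (m + n) z = iteratedComp E k m (iteratedComp E (k + m) n z) := by
  induction n generalizing z with
  | zero => rfl
  | succ n ih =>
    rw [← add_assoc]
    simp only [iteratedComp]
    rw [ih, add_assoc k m n]

lemma iteratedComp_succ' (E : ℕ → ℂ → ℂ) (k m : ℕ) (z : ℂ) :
    iteratedComp E k (m + 1) z = E k (iteratedComp E (k + 1) m z) := by
  rw [add_comm, iteratedComp_add]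
  rfl

lemma differentiable_iteratedComp {E : ℕ → ℂ → ℂ} (hE : ∀ j, Differentiable ℂ (E j)) (k m : ℕ) :
    Differentiable ℂ (iteratedComp E k m) := by
  induction m with
  | zero => exact differentiable_id
  | succ m ih => exact ih.comp (hE (k + m))

lemma norm_iteratedComp_sub_le {E : ℕ → ℂ → ℂ}
    (hclose : ∀ (j : ℕ) (z : ℂ), ‖z‖ ≤ j + 2 → ‖E j z - z‖ ≤ (1 / 2) ^ (j + 1)) (m : ℕ) :
    ∀ (k : ℕ) (z : ℂ), ‖z‖ ≤ k + 1 → ‖iteratedComp E k m z - z‖ ≤ (1 / 2) ^ k := by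
  induction m with
  | zero => intro k z _; simp [iteratedComp]
  | succ m ih =>
    intro k z hz
    rw [iteratedComp_succ']
    set y := iteratedComp E (k + 1) m z
    have h1 : ‖y - z‖ ≤ (1 / 2) ^ (k + 1) := ih (k + 1) z (by push_cast; linarith)
    have h2 : ((1 : ℝ) / 2) ^ (k + 1) ≤ 1 := pow_le_one₀ (by norm_num) (by norm_num)
    have h3 := norm_le_norm_add_norm_sub' y z
    have h4 := hclose k y (by linarith)
    calc ‖E k y - z‖ = ‖(E k y - y) + (y - z)‖ := by ring_nf
      _ ≤ (1 / 2) ^ (k + 1) + (1 / 2) ^ (k + 1) := (norm_add_le _ _).trans (add_le_add h4 h1)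
      _ = (1 / 2) ^ k := by rw [pow_succ]; ring

/-- The partial compositions are bounded near each disc uniformly in `m`, hence equi-Lipschitz by
Cauchy's estimate, and two of them differ by an inner map that is nearly the identity. -/
lemma uniformCauchySeqOn_iteratedComp {E : ℕ → ℂ → ℂ} (hE : ∀ j, Differentiable ℂ (E j))
    (hclose : ∀ (j : ℕ) (z : ℂ), ‖z‖ ≤ j + 2 → ‖E j z - z‖ ≤ (1 / 2) ^ (j + 1)) (k N : ℕ) :
    UniformCauchySeqOn (iteratedComp E k) atTop (closedBall 0 N) := by
  have hpow : ∀ n : ℕ, ((1 : ℝ) / 2) ^ n ≤ 1 := fun n => pow_le_one₀ (by norm_num) (by norm_num)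
  have hd := differentiable_iteratedComp hE
  obtain ⟨B, hB⟩ := (isCompact_closedBall (0 : ℂ) (N + 4)).exists_bound_of_continuousOn
    (hd k (N + 2)).continuous.continuousOn
  have hbound : ∀ (j : ℕ) (z : ℂ), ‖z‖ ≤ N + 3 → ‖iteratedComp E k (N + 2 + j) z‖ ≤ B := by
    intro j z hz
    rw [iteratedComp_add]
    refine hB _ (mem_closedBall_zero_iff.2 ?_)
    have h1 := norm_iteratedComp_sub_le hclose j (k + (N + 2)) z (by
      push_cast
      have : (0 : ℝ) ≤ k := k.cast_nonneg
      linarith)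
    have := norm_le_norm_add_norm_sub' (iteratedComp E (k + (N + 2)) j z) z
    linarith [hpow (k + (N + 2))]
  have hB0 : 0 ≤ B := (norm_nonneg _).trans (hbound 0 0 (by rw [norm_zero]; positivity))
  have hlip : ∀ (j : ℕ) (x y : ℂ), ‖x‖ ≤ N + 2 → ‖y‖ ≤ N + 2 →
      ‖iteratedComp E k (N + 2 + j) x - iteratedComp E k (N + 2 + j) y‖ ≤ B * ‖x - y‖ := by
    intro j x y hx hy
    refine Convex.norm_image_sub_le_of_norm_deriv_le (s := closedBall (0 : ℂ) (N + 2))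
      (fun z _ => hd k _ z) (fun z hz => ?_) (convex_closedBall _ _)
      (mem_closedBall_zero_iff.2 hy) (mem_closedBall_zero_iff.2 hx)
    have := Complex.norm_deriv_le_of_forall_mem_sphere_norm_le (c := z) one_pos
      (hd k (N + 2 + j)).diffContOnCl (fun u hu => hbound j u (by
        have h1 := norm_le_norm_add_norm_sub' u z
        rw [mem_sphere_iff_norm.1 hu] at h1
        linarith [mem_closedBall_zero_iff.1 hz]))
    simpa using this
  rw [Metric.uniformCauchySeqOn_iff]
  intro ε hε
  obtain ⟨j, hj⟩ : ∃ j : ℕ, B * (1 / 2) ^ j < ε / 2 := by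
    have : Tendsto (fun j : ℕ => B * (1 / 2 : ℝ) ^ j) atTop (𝓝 (B * 0)) :=
      (tendsto_pow_atTop_nhds_zero_of_lt_one (by norm_num) (by norm_num)).const_mul B
    rw [mul_zero] at this
    exact (this.eventually (gt_mem_nhds (half_pos hε))).exists
  have key : ∀ m ≥ N + 2 + j, ∀ z ∈ closedBall (0 : ℂ) N,
      dist (iteratedComp E k m z) (iteratedComp E k (N + 2 + j) z) < ε / 2 := by
    intro m hm z hz
    obtain ⟨i, rfl⟩ := Nat.exists_eq_add_of_le hm
    have hz' : ‖z‖ ≤ N := mem_closedBall_zero_iff.1 hz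
    have h1 := norm_iteratedComp_sub_le hclose i (k + (N + 2 + j)) z (by
      push_cast
      have h1 : (0 : ℝ) ≤ k := k.cast_nonneg
      have h2 : (0 : ℝ) ≤ j := j.cast_nonneg
      linarith)
    have h2 := norm_le_norm_add_norm_sub' (iteratedComp E (k + (N + 2 + j)) i z) z
    rw [iteratedComp_add, dist_eq_norm]
    refine (hlip j _ z (by linarith [hpow (k + (N + 2 + j))]) (by linarith)).trans_lt
      (lt_of_le_of_lt ?_ hj)
    refine mul_le_mul_of_nonneg_left (h1.trans ?_) hB0
    exact pow_le_pow_of_le_one (by norm_num) (by norm_num) (by omega)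
  refine ⟨N + 2 + j, fun m hm n hn z hz => ?_⟩
  have h1 := key m hm z hz
  have h2 := key n hn z hz
  have := dist_triangle_right (iteratedComp E k m z) (iteratedComp E k n z)
    (iteratedComp E k (N + 2 + j) z)
  linarith

/-- If the entire maps `E j` approach the identity fast enough, the infinite compositions
`G k = E k ∘ E (k + 1) ∘ ⋯` exist and approach the identity. -/
lemma exists_infinite_comp {E : ℕ → ℂ → ℂ} (hE : ∀ j, Differentiable ℂ (E j))
    (hclose : ∀ (j : ℕ) (z : ℂ), ‖z‖ ≤ j + 2 → ‖E j z - z‖ ≤ (1 / 2) ^ (j + 1)) :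
    ∃ G : ℕ → ℂ → ℂ, (∀ k, Differentiable ℂ (G k)) ∧ (∀ k z, E k (G (k + 1) z) = G k z) ∧
      ∀ (k : ℕ) (z : ℂ), ‖z‖ ≤ k + 1 → ‖G k z - z‖ ≤ (1 / 2) ^ k := by
  have hball : ∀ z : ℂ, ∃ N : ℕ, z ∈ ball (0 : ℂ) N := fun z => by
    obtain ⟨N, hN⟩ := exists_nat_gt ‖z‖
    exact ⟨N, mem_ball_zero_iff.2 hN⟩
  have hex : ∀ (k : ℕ) (z : ℂ), ∃ w, Tendsto (fun m => iteratedComp E k m z) atTop (𝓝 w) := by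
    intro k z
    obtain ⟨N, hN⟩ := hball z
    exact cauchySeq_tendsto_of_complete
      ((uniformCauchySeqOn_iteratedComp hE hclose k N).cauchySeq (ball_subset_closedBall hN))
  choose G hG using hex
  refine ⟨G, fun k z => ?_, fun k z => ?_, fun k z hz => ?_⟩
  · obtain ⟨N, hN⟩ := hball z
    have h1 : TendstoUniformlyOn (iteratedComp E k) (G k) atTop (ball 0 N) :=
      ((uniformCauchySeqOn_iteratedComp hE hclose k N).mono
        ball_subset_closedBall).tendstoUniformlyOn_of_tendsto fun z _ => hG k z
    exact (h1.tendstoLocallyUniformlyOn.differentiableOn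
      (Eventually.of_forall fun m => (differentiable_iteratedComp hE k m).differentiableOn)
      isOpen_ball).differentiableAt (isOpen_ball.mem_nhds hN)
  · refine tendsto_nhds_unique ?_ ((tendsto_add_atTop_iff_nat 1).2 (hG k z))
    simp only [iteratedComp_succ']
    exact ((hE k).continuous.tendsto _).comp (hG (k + 1) z)
  · exact le_of_tendsto ((hG k z).sub_const z).norm
      (Eventually.of_forall fun m => norm_iteratedComp_sub_le hclose m k z hz)

/-! ### The construction -/


/-- The function `z ↦ b (1 - exp (-z / b))`. It omits the value `b` only, and is close to the
identity on large discs when `b` is large. -/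
noncomputable def omitExp (b z : ℂ) : ℂ := b + -b * Complex.exp (-b⁻¹ * z)

lemma hasDerivAt_omitExp {b : ℂ} (hb : b ≠ 0) (z : ℂ) :
    HasDerivAt (omitExp b) (Complex.exp (-b⁻¹ * z)) z := by
  refine ((((hasDerivAt_id z).const_mul (-b⁻¹)).cexp.const_mul (-b)).const_add b).congr_deriv ?_
  simp only [id]
  field_simp

lemma omitExp_ne {b : ℂ} (hb : b ≠ 0) (z : ℂ) : omitExp b z ≠ b := by
  simp [omitExp, hb, Complex.exp_ne_zero]

lemma exists_omitExp_eq {b w : ℂ} (hb : b ≠ 0) (hw : w ≠ b) : ∃ z, omitExp b z = w := by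
  refine ⟨-b * Complex.log ((w - b) / -b), ?_⟩
  have h : -b⁻¹ * (-b * Complex.log ((w - b) / -b)) = Complex.log ((w - b) / -b) := by
    field_simp
  rw [omitExp, h, Complex.exp_log (div_ne_zero (sub_ne_zero.2 hw) (neg_ne_zero.2 hb))]
  field_simp
  ring

lemma exists_omitExp_close (r : ℝ) {ε : ℝ} (hε : 0 < ε) :
    ∃ M : ℝ, ∀ b : ℂ, M < ‖b‖ → ∀ z : ℂ, ‖z‖ ≤ r → ‖omitExp b z - z‖ ≤ ε := by
  refine ⟨max (r ^ 2 / ε) (max r 0), fun b hb z hz => ?_⟩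
  have hb1 : r ^ 2 / ε < ‖b‖ := (le_max_left _ _).trans_lt hb
  have hb2 : r < ‖b‖ := ((le_max_left _ _).trans (le_max_right _ _)).trans_lt hb
  have hb0 : 0 < ‖b‖ := ((le_max_right _ _).trans (le_max_right _ _)).trans_lt hb
  have hbne : b ≠ 0 := norm_pos_iff.1 hb0
  have hu : ‖-b⁻¹ * z‖ = ‖z‖ / ‖b‖ := by rw [norm_mul, norm_neg, norm_inv]; ring
  have h1 := Complex.norm_exp_sub_one_sub_id_le (x := -b⁻¹ * z) (by
    rw [hu, div_le_one hb0]; linarith)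
  have heq : omitExp b z - z = -b * (Complex.exp (-b⁻¹ * z) - 1 - -b⁻¹ * z) := by
    rw [omitExp]; field_simp; ring
  rw [heq, norm_mul, norm_neg]
  calc ‖b‖ * ‖Complex.exp (-b⁻¹ * z) - 1 - -b⁻¹ * z‖ ≤ ‖b‖ * (‖z‖ / ‖b‖) ^ 2 := by
        rw [← hu]; gcongr
    _ = ‖z‖ ^ 2 / ‖b‖ := by field_simp
    _ ≤ r ^ 2 / ‖b‖ := by gcongr
    _ ≤ ε := by
        rw [div_le_iff₀ hb0]
        rw [div_lt_iff₀ hε] at hb1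
        linarith

/-- The properties preserved along the construction: `F` is a locally univalent entire function
with inverse branches over `U`, and it takes every value other than `a` at points of arbitrarily
large modulus. -/
structure Admissible (a : ℂ) (U : Set ℂ) (F : ℂ → ℂ) : Prop where
  differentiable : Differentiable ℂ F
  deriv_ne_zero : ∀ z, deriv F z ≠ 0
  hasBranches : HasBranches F U
  exists_large : ∀ v, v ≠ a → ∀ r : ℝ, ∃ z, r < ‖z‖ ∧ F z = v

lemma admissible_add_exp {a : ℂ} {U : Set ℂ} (ha : a ∉ U) :
    Admissible a U fun z => a + Complex.exp z where
  differentiable := by fun_prop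
  deriv_ne_zero z := by simp [Complex.exp_ne_zero]
  hasBranches := by
    simpa using (hasBranches_id U).comp_exp (β := a) one_ne_zero one_ne_zero ha
  exists_large v hv r := by
    obtain ⟨n, hn⟩ := exists_nat_gt r
    refine ⟨Complex.log (v - a) + (n + 1 : ℕ) * (2 * Real.pi * Complex.I), ?_, ?_⟩
    · refine hn.trans_le (le_trans ?_ (Complex.abs_im_le_norm _))
      refine le_trans ?_ (le_abs_self _)
      have h1 := Complex.neg_pi_lt_arg (v - a)
      have h2 := Real.pi_gt_three
      have h3 : (0 : ℝ) ≤ n := n.cast_nonneg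
      simp only [Complex.add_im, Complex.log_im, Complex.mul_im, Complex.natCast_re,
        Complex.natCast_im, Complex.mul_re, Complex.I_re, Complex.I_im, Complex.ofReal_re,
        Complex.ofReal_im, Complex.re_ofNat, Complex.im_ofNat]
      push_cast
      nlinarith
    · rw [Complex.exp_add, Complex.exp_nat_mul_two_pi_mul_I, mul_one,
        Complex.exp_log (sub_ne_zero.2 hv)]
      ring

lemma Admissible.comp_omitExp {a : ℂ} {U : Set ℂ} {F : ℂ → ℂ} (hF : Admissible a U F) {b : ℂ}
    (hb : b ≠ 0) (hbU : F b ∉ U) : Admissible a U fun z => F (omitExp b z) where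
  differentiable := hF.differentiable.comp fun z => (hasDerivAt_omitExp hb z).differentiableAt
  deriv_ne_zero z := by
    have := (hF.differentiable _).hasDerivAt.comp z (hasDerivAt_omitExp hb z)
    rw [show (fun z => F (omitExp b z)) = F ∘ omitExp b from rfl, this.deriv]
    exact mul_ne_zero (hF.deriv_ne_zero _) (Complex.exp_ne_zero _)
  hasBranches := hF.hasBranches.comp_exp (neg_ne_zero.2 hb) (neg_ne_zero.2 (inv_ne_zero hb)) hbU
  exists_large v hv r := by
    have hcont : Continuous (omitExp b) :=
      continuous_iff_continuousAt.2 fun z => (hasDerivAt_omitExp hb z).continuousAt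
    obtain ⟨B, hB⟩ := (isCompact_closedBall (0 : ℂ) r).exists_bound_of_continuousOn
      hcont.continuousOn
    obtain ⟨w, hw, hwv⟩ := hF.exists_large v hv (max B ‖b‖)
    obtain ⟨z, rfl⟩ := exists_omitExp_eq (w := w) hb (by
      rintro rfl
      exact absurd hw (not_lt.2 (le_max_right _ _)))
    refine ⟨z, ?_, hwv⟩
    by_contra! hz
    exact absurd hw (not_lt.2 ((hB z (mem_closedBall_zero_iff.2 hz)).trans (le_max_left _ _)))

lemma singularValues_eq_closure {f : ℂ → ℂ} (hf' : ∀ z, deriv f z ≠ 0) :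
    singularValues f = closure (asymptoticValues f) := by
  have : criticalValues f = ∅ :=
    Set.eq_empty_iff_forall_notMem.2 fun w ⟨z, hz, _⟩ => hf' z hz
  rw [singularValues, this, Set.union_empty]

/-- A locally univalent entire function with inverse branches over `U` has no asymptotic value
in `U`. -/
lemma HasBranches.asymptoticValues_subset_compl {f : ℂ → ℂ} {U : Set ℂ} (hU : IsOpen U)
    (hf : Differentiable ℂ f) (hf' : ∀ z, deriv f z ≠ 0) (hB : HasBranches f U) :
    asymptoticValues f ⊆ Uᶜ :=
  EntireFunction.asymptoticValues_subset_compl (F := fun _ => f) (G := fun _ => id) hU hf hf'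
    (fun _ => hf) (fun _ => hf') (fun _ => differentiable_id) (fun _ _ => rfl)
    (fun _ ε hε => Eventually.of_forall fun _ z _ => by simpa using hε.le) fun _ => hB

/-- The construction of `f` from a sequence `v` of values different from `a`. -/
lemma exists_entire_of_seq {V : Set ℂ} (hV : IsClosed V) {a : ℂ} (ha : a ∈ V) {v : ℕ → ℂ}
    (hv : ∀ n, v n ∈ V) (hva : ∀ n, v n ≠ a) :
    ∃ f : ℂ → ℂ, Differentiable ℂ f ∧ (∀ z, deriv f z ≠ 0) ∧ asymptoticValues f ⊆ V ∧
      a ∈ closure (asymptoticValues f) ∧ ∀ n, v n ∈ closure (asymptoticValues f) := by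
  have hstep : ∀ (F : {F : ℂ → ℂ // Admissible a Vᶜ F}) (j : ℕ), ∃ b : ℂ, b ≠ 0 ∧ F.1 b = v j ∧
      ∀ z : ℂ, ‖z‖ ≤ j + 2 → ‖omitExp b z - z‖ ≤ (1 / 2) ^ (j + 1) := by
    intro F j
    obtain ⟨M, hM⟩ := exists_omitExp_close (j + 2) (ε := (1 / 2) ^ (j + 1)) (by positivity)
    obtain ⟨b, hb, hbv⟩ := F.2.exists_large (v j) (hva j) (max M 0)
    exact ⟨b, norm_pos_iff.1 ((le_max_right _ _).trans_lt hb), hbv,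
      hM b ((le_max_left _ _).trans_lt hb)⟩
  choose b hb0 hbv hbc using hstep
  let F : ℕ → {F : ℂ → ℂ // Admissible a Vᶜ F} := fun n =>
    Nat.rec ⟨_, admissible_add_exp (fun h => h ha)⟩
      (fun j F => ⟨_, F.2.comp_omitExp (hb0 F j) (by rw [hbv F j]; exact fun h => h (hv j))⟩) n
  have hF0 : ∀ z, (F 0).1 z = a + Complex.exp z := fun z => rfl
  have hFs : ∀ j z, (F (j + 1)).1 z = (F j).1 (omitExp (b (F j) j) z) := fun j z => rfl
  obtain ⟨G, hG, hGE, hGc⟩ := exists_infinite_comp (E := fun j => omitExp (b (F j) j))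
    (fun j z => (hasDerivAt_omitExp (hb0 (F j) j) z).differentiableAt) fun j => hbc (F j) j
  set f : ℂ → ℂ := fun z => (F 0).1 (G 0 z) with hf
  have hfac : ∀ n z, (F n).1 (G n z) = f z := by
    intro n
    induction n with
    | zero => intro z; rfl
    | succ n ih => intro z; rw [hFs, hGE n z, ih z]
  have hfd : Differentiable ℂ f := (F 0).2.differentiable.comp (hG 0)
  have hderiv : ∀ n z, deriv f z = deriv (F n).1 (G n z) * deriv (G n) z := by
    intro n z
    have h1 := ((F n).2.differentiable (G n z)).hasDerivAt.comp z (hG n z).hasDerivAt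
    rw [← h1.deriv]
    congr 1
    exact funext fun z => (hfac n z).symm
  have hf' : ∀ z, deriv f z ≠ 0 := by
    intro z
    -- For large `n`, Cauchy's estimate makes `deriv (G n) z` close to `1`.
    obtain ⟨n, hn⟩ := exists_nat_gt ‖z‖
    rw [hderiv (n + 1) z]
    refine mul_ne_zero ((F (n + 1)).2.deriv_ne_zero _) fun h0 => ?_
    have h1 := Complex.norm_deriv_le_of_forall_mem_sphere_norm_le (c := z) (C := 1 / 2)
      (f := fun w => G (n + 1) w - w) one_pos
      ((hG (n + 1)).sub differentiable_id).diffContOnCl (fun u hu => by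
        have h1 := norm_le_norm_add_norm_sub' u z
        rw [mem_sphere_iff_norm.1 hu] at h1
        refine (hGc (n + 1) u (by push_cast; linarith)).trans ?_
        rw [pow_succ]
        have : ((1 : ℝ) / 2) ^ n ≤ 1 := pow_le_one₀ (by norm_num) (by norm_num)
        linarith)
    have h2 : deriv (fun w => G (n + 1) w - w) z = deriv (G (n + 1)) z - 1 :=
      ((hG (n + 1) z).hasDerivAt.sub (hasDerivAt_id z)).deriv
    rw [h2, h0] at h1
    norm_num at h1
  have hG' : ∀ n z, deriv (G n) z ≠ 0 := fun n z h0 => hf' z (by rw [hderiv n z, h0, mul_zero])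
  refine ⟨f, hfd, hf', ?_, ?_, fun n => ?_⟩
  · rw [← compl_compl V]
    refine asymptoticValues_subset_compl hV.isOpen_compl hfd hf'
      (fun n => (F n).2.differentiable) (fun n => (F n).2.deriv_ne_zero) hG hfac
      (fun r ε hε => ?_) fun n => (F n).2.hasBranches
    have h1 : Tendsto (fun n : ℕ => ((1 : ℝ) / 2) ^ n) atTop (𝓝 0) :=
      tendsto_pow_atTop_nhds_zero_of_lt_one (by norm_num) (by norm_num)
    filter_upwards [h1.eventually (ge_mem_nhds hε),
      tendsto_natCast_atTop_atTop.eventually (eventually_ge_atTop r)] with n hn hr z hz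
    exact (hGc n z (by linarith)).trans hn
  · exact mem_closure_asymptoticValues_of_omitted hfd hf' fun z => by
      simp only [hf, hF0]
      simp [Complex.exp_ne_zero]
  · -- `G n` omits `b n`, and `F n` maps asymptotic values of `G n` to asymptotic values of `f`.
    have h1 := mem_closure_asymptoticValues_of_omitted (hG n) (hG' n) (c := b (F n) n)
      fun z => by rw [← hGE n z]; exact omitExp_ne (hb0 _ _) _
    have hc : Continuous (F n).1 := (F n).2.differentiable.continuous
    rw [← hbv (F n) n]
    refine closure_mono ?_ (image_closure_subset_closure_image hc ⟨_, h1, rfl⟩)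
    rintro _ ⟨w, ⟨γ, hγ1, hγ2, hγ3⟩, rfl⟩
    refine ⟨γ, hγ1, hγ2, ?_⟩
    simp only [← hfac n]
    exact (hc.tendsto w).comp hγ3

lemma exists_entire_of_isClosed {V : Set ℂ} (hV : IsClosed V) :
    ∃ f : ℂ → ℂ, Differentiable ℂ f ∧ (∀ z, deriv f z ≠ 0) ∧ asymptoticValues f ⊆ V ∧
      V ⊆ closure (asymptoticValues f) := by
  rcases V.eq_empty_or_nonempty with rfl | ⟨a, ha⟩
  · have h' : ∀ z : ℂ, deriv (id : ℂ → ℂ) z ≠ 0 := fun z => by simp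
    refine ⟨id, differentiable_id, h', ?_, Set.empty_subset _⟩
    simpa using (hasBranches_id Set.univ).asymptoticValues_subset_compl isOpen_univ
      differentiable_id h'
  rcases (V \ {a}).eq_empty_or_nonempty with hVa | hne
  · have hsub : V ⊆ {a} := Set.sdiff_eq_empty.1 hVa
    have hadm := admissible_add_exp (a := a) (U := Vᶜ) fun h => h ha
    refine ⟨_, hadm.differentiable, hadm.deriv_ne_zero, ?_, hsub.trans ?_⟩
    · simpa using hadm.hasBranches.asymptoticValues_subset_compl hV.isOpen_compl
        hadm.differentiable hadm.deriv_ne_zero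
    · rw [Set.singleton_subset_iff]
      exact mem_closure_asymptoticValues_of_omitted hadm.differentiable hadm.deriv_ne_zero
        fun z => by simp [Complex.exp_ne_zero]
  · have : Nonempty ↥(V \ {a}) := hne.to_subtype
    let v : ℕ → ℂ := fun n => (TopologicalSpace.denseSeq ↥(V \ {a}) n : ℂ)
    obtain ⟨f, hf, hf', h1, h2, h3⟩ := exists_entire_of_seq hV ha (v := v)
      (fun n => (TopologicalSpace.denseSeq ↥(V \ {a}) n).2.1)
      (fun n => (TopologicalSpace.denseSeq ↥(V \ {a}) n).2.2)
    refine ⟨f, hf, hf', h1, fun w hw => ?_⟩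
    by_cases hwa : w = a
    · rwa [hwa]
    · have hd := TopologicalSpace.denseRange_denseSeq ↥(V \ {a}) ⟨w, hw, hwa⟩
      have hmem := image_closure_subset_closure_image continuous_subtype_val ⟨_, hd, rfl⟩
      refine closure_minimal ?_ isClosed_closure hmem
      rintro _ ⟨_, ⟨n, rfl⟩, rfl⟩
      exact h3 n

end EntireFunction

theorem corollary2 (V : Set ℂ) (hV : IsClosed V) :
    ∃ f : ℂ → ℂ, Differentiable ℂ f ∧ EntireFunction.LocallyUnivalent f ∧
      EntireFunction.singularValues f = V := by
  obtain ⟨f, hf, hf', h1, h2⟩ := EntireFunction.exists_entire_of_isClosed hV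
  refine ⟨f, hf, EntireFunction.locallyUnivalent_of_deriv_ne_zero hf hf', ?_⟩
  rw [EntireFunction.singularValues_eq_closure hf']
  exact (hV.closure_subset_iff.2 h1).antisymm h2
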